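/- Let $p$ be a prime, let $\mathbb{F} = \mathbb{Z}/p\mathbb{Z}$, and let $e_{\mathbb{F}}(j) := e^{2\pi i j/p}$ for $j \in \mathbb{F}$. A function $P : \mathbb{F}^n \to \mathbb{F}$ is called a polynomial of degree at most $d$ (for an integer $d \ge -1$) if $D_{h_1} \cdots D_{h_{d+1}} P = 0$ for all $h_1, \dots, h_{d+1} \in \mathbb{F}^n$, where $D_h P(x) := P(x+h) - P(x)$; in particular, for $d = -1$ this means $P = 0$. The degree $d$ rank $\mathrm{rank}_d(P)$ of a function $P : \mathbb{F}^n \to \mathbb{F}$ is the least integer $k \ge 0$ for which there are polynomials $Q_1, \dots, Q_k : \mathbb{F}^n \to \mathbb{F}$ of degree at most $d$ and a function $B : \mathbb{F}^k \to \mathbb{F}$ with $P = B(Q_1, \dots, Q_k)$, and it is $\infty$ if there is no such $k$. **Theorem (Lack of equidistribution implies bounded rank).** Let $d$ be an integer with $0 \le d < |\mathbb{F}| = p$ and let $\delta \in (0,1]$. There is a constant $C$ depending only on $\mathbb{F}$, $\delta$ and $d$ such that, for every integer $n \ge 0$ and every polynomial $P : \mathbb{F}^n \to \mathbb{F}$ of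 degree at most $d$ with $$\Bigl| \frac{1}{|\mathbb{F}|^n} \sum_{x \in \mathbb{F}^n} e_{\mathbb{F}}(P(x)) \Bigr| \ge \delta,$$ one has $\mathrm{rank}_{d-1}(P) \le C$. -/

import Mathlib

open scoped BigOperators

/-- The iterated additive derivative `D_{h₁} ⋯ D_{hₘ} P` for `hs = [h₁, …, hₘ]`, where
`D_h P x = P (x + h) - P x` is Mathlib's `fwdDiff h P x`. -/
def iterAddDeriv {p n : ℕ} (hs : List (Fin n → ZMod p))
    (P : (Fin n → ZMod p) → ZMod p) : (Fin n → ZMod p) → ZMod p :=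
  hs.foldr (fun h Q => fwdDiff h Q) P

/-- `P : 𝔽ⁿ → 𝔽` is a polynomial of degree at most `d`: all its `(d + 1)`-fold additive
derivatives vanish. The degree bound is an integer, so that `d = -1` is allowed; it means
`P = 0`. -/
def IsPolyDegreeLE {p n : ℕ} (d : ℤ) (P : (Fin n → ZMod p) → ZMod p) : Prop :=
  ∀ hs : List (Fin n → ZMod p), hs.length = (d + 1).toNat → iterAddDeriv hs P = 0

/-- `P = B(Q₁, …, Q_k)` for some polynomials `Q₁, …, Q_k` of degree at most `d` and some
function `B : 𝔽ᵏ → 𝔽`. -/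
def IsFunctionOfPolys {p n : ℕ} (d : ℤ) (k : ℕ) (P : (Fin n → ZMod p) → ZMod p) : Prop :=
  ∃ (Q : Fin k → (Fin n → ZMod p) → ZMod p) (B : (Fin k → ZMod p) → ZMod p),
    (∀ i, IsPolyDegreeLE d (Q i)) ∧ ∀ x, P x = B (fun i => Q i x)

/-- The degree `d` rank of `P`: the least `k` such that `P` is a function of `k` polynomials
of degree at most `d`, and `⊤` if there is no such `k`. -/
noncomputable def degreeRank {p n : ℕ} (d : ℤ) (P : (Fin n → ZMod p) → ZMod p) : ℕ∞ :=
  ⨅ (k : ℕ) (_ : IsFunctionOfPolys d k P), (k : ℕ∞)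

section Polynomials

variable {p : ℕ} {V W : Type} [AddCommGroup V] [AddCommGroup W]

/-- `P` is a polynomial of degree less than `k` on an additive group: all its `k`-fold additive
derivatives vanish. -/
def PolyDegLT : ℕ → (V → ZMod p) → Prop
  | 0, P => P = 0
  | k + 1, P => ∀ h, PolyDegLT k (fwdDiff h P)

lemma polyDegLT_zero {P : V → ZMod p} : PolyDegLT 0 P ↔ P = 0 := Iff.rfl

lemma polyDegLT_succ {k : ℕ} {P : V → ZMod p} :
    PolyDegLT (k + 1) P ↔ ∀ h, PolyDegLT k (fwdDiff h P) := Iff.rfl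

lemma PolyDegLT.zero (k : ℕ) : PolyDegLT k (0 : V → ZMod p) := by
  induction k with
  | zero => exact rfl
  | succ k ih =>
    intro h
    have : fwdDiff h (0 : V → ZMod p) = 0 := by ext; simp [fwdDiff]
    rwa [this]

lemma PolyDegLT.add {k : ℕ} {P Q : V → ZMod p} (hP : PolyDegLT k P) (hQ : PolyDegLT k Q) :
    PolyDegLT k (P + Q) := by
  induction k generalizing P Q with
  | zero => rw [polyDegLT_zero] at *; simp [hP, hQ]
  | succ k ih =>
    intro h
    rw [fwdDiff_add]
    exact ih (hP h) (hQ h)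

lemma PolyDegLT.smul {k : ℕ} {P : V → ZMod p} (c : ZMod p) (hP : PolyDegLT k P) :
    PolyDegLT k (c • P) := by
  induction k generalizing P with
  | zero => rw [polyDegLT_zero] at *; simp [hP]
  | succ k ih =>
    intro h
    rw [fwdDiff_const_smul]
    exact ih (hP h)

lemma PolyDegLT.neg {k : ℕ} {P : V → ZMod p} (hP : PolyDegLT k P) : PolyDegLT k (-P) := by
  simpa using hP.smul (-1)

lemma PolyDegLT.sub {k : ℕ} {P Q : V → ZMod p} (hP : PolyDegLT k P) (hQ : PolyDegLT k Q) :
    PolyDegLT k (P - Q) := by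
  rw [sub_eq_add_neg]
  exact hP.add hQ.neg

lemma PolyDegLT.sum {ι : Type*} {k : ℕ} {s : Finset ι} {P : ι → V → ZMod p}
    (hP : ∀ i ∈ s, PolyDegLT k (P i)) : PolyDegLT k (∑ i ∈ s, P i) :=
  Finset.sum_induction _ (PolyDegLT k) (fun _ _ => PolyDegLT.add) (PolyDegLT.zero k) hP

lemma PolyDegLT.succ {k : ℕ} {P : V → ZMod p} (hP : PolyDegLT k P) : PolyDegLT (k + 1) P := by
  induction k generalizing P with
  | zero =>
    rw [polyDegLT_zero] at hP
    rw [hP]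
    exact PolyDegLT.zero _
  | succ k ih => exact fun h => ih (hP h)

lemma PolyDegLT.mono {k l : ℕ} (hkl : k ≤ l) {P : V → ZMod p} (hP : PolyDegLT k P) :
    PolyDegLT l P := by
  induction hkl with
  | refl => exact hP
  | step _ ih => exact ih.succ

lemma PolyDegLT.comp {k : ℕ} {P : V → ZMod p} (hP : PolyDegLT k P) (φ : W →+ V) :
    PolyDegLT k (fun w => P (φ w)) := by
  induction k generalizing P with
  | zero =>
    rw [polyDegLT_zero] at *
    ext
    simp [hP]
  | succ k ih =>
    intro h
    have : fwdDiff h (fun w => P (φ w)) = fun w => fwdDiff (φ h) P (φ w) := by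
      ext; simp [fwdDiff]
    rw [this]
    exact ih (hP (φ h))

lemma fwdDiff_comm' (a b : V) (P : V → ZMod p) :
    fwdDiff a (fwdDiff b P) = fwdDiff b (fwdDiff a P) := by
  ext x
  simp only [fwdDiff, add_right_comm x a b]
  ring

/-- The alternating sum of a polynomial of degree less than `#S` over a cube of dimension `#S`
vanishes. -/
lemma PolyDegLT.sum_cube_eq_zero {K : Type*} [DecidableEq K] {k : ℕ} {P : V → ZMod p}
    (hP : PolyDegLT k P) (S : Finset K) (hS : k ≤ S.card) (x : V) (h : K → V) :
    ∑ T ∈ S.powerset, (-1) ^ T.card * P (x + ∑ i ∈ T, h i) = 0 := by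
  induction S using Finset.induction_on generalizing k P with
  | empty =>
    obtain rfl : k = 0 := by simpa using hS
    rw [polyDegLT_zero] at hP
    simp [hP]
  | insert a S ha ih =>
    cases k with
    | zero =>
      rw [polyDegLT_zero] at hP
      simp [hP]
    | succ k =>
      rw [Finset.card_insert_of_notMem ha] at hS
      rw [Finset.sum_powerset_insert ha, ← Finset.sum_add_distrib, ← neg_eq_zero,
        ← Finset.sum_neg_distrib, ← ih (hP (h a)) (by omega)]
      refine Finset.sum_congr rfl fun T hT => ?_
      have haT : a ∉ T := fun h' => ha (Finset.mem_powerset.1 hT h')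
      rw [Finset.card_insert_of_notMem haT, Finset.sum_insert haT, fwdDiff,
        add_comm (h a), ← add_assoc]
      ring

lemma fwdDiff_nsmul_sub {k : ℕ} {P : V → ZMod p} (hP : PolyDegLT (k + 2) P) (j : ℕ) (h : V) :
    PolyDegLT k (fwdDiff (j • h) P - (j : ZMod p) • fwdDiff h P) := by
  induction j with
  | zero =>
    have : fwdDiff (0 • h) P - ((0 : ℕ) : ZMod p) • fwdDiff h P = 0 := by
      ext; simp [fwdDiff]
    rw [this]
    exact PolyDegLT.zero k
  | succ j ih =>
    have : fwdDiff ((j + 1) • h) P - ((j + 1 : ℕ) : ZMod p) • fwdDiff h P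
        = (fwdDiff (j • h) P - (j : ZMod p) • fwdDiff h P) + fwdDiff h (fwdDiff (j • h) P) := by
      ext x
      simp only [fwdDiff, Pi.sub_apply, Pi.add_apply, Pi.smul_apply, smul_eq_mul, add_smul,
        one_smul]
      rw [add_comm (j • h) h, ← add_assoc]
      push_cast
      ring
    rw [this]
    exact ih.add (hP _ _)

/-- Up to lower degree terms, a polynomial of degree at most `k` is homogeneous of degree `k`. -/
lemma PolyDegLT.comp_nsmul_sub {k : ℕ} {P : V → ZMod p} (hP : PolyDegLT (k + 1) P) (j : ℕ) :
    PolyDegLT k ((fun x => P (j • x)) - (j : ZMod p) ^ k • P) := by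
  induction k generalizing P with
  | zero =>
    rw [polyDegLT_zero]
    ext x
    have := congrFun (hP (j • x - x)) x
    simpa [fwdDiff] using this
  | succ k ih =>
    intro h
    have : fwdDiff h ((fun x => P (j • x)) - (j : ZMod p) ^ (k + 1) • P)
        = (fun x => (fwdDiff (j • h) P - (j : ZMod p) • fwdDiff h P) (nsmulAddMonoidHom j x))
          + (j : ZMod p) • ((fun x => fwdDiff h P (j • x)) - (j : ZMod p) ^ k • fwdDiff h P) := by
      ext x
      simp only [fwdDiff, Pi.sub_apply, Pi.add_apply, Pi.smul_apply, smul_eq_mul, smul_add,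
        nsmulAddMonoidHom_apply]
      ring
    rw [this]
    exact ((fwdDiff_nsmul_sub hP j h).comp _).add ((ih (hP h)).smul _)

lemma PolyDegLT.iterate_fwdDiff_sub {k : ℕ} {P : V → ZMod p} (hP : PolyDegLT (k + 1) P) :
    PolyDegLT k ((fun x => (fwdDiff x)^[k] P 0) - (k.factorial : ZMod p) • P) := by
  have hfac : (k.factorial : ZMod p)
      = ∑ j ∈ Finset.range (k + 1), ((-1 : ℤ) ^ (k - j) * (k.choose j)) • (j : ZMod p) ^ k := by
    have h1 := fwdDiff_iter_eq_factorial (R := ZMod p) (n := k)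
    have h2 := fwdDiff_iter_eq_sum_shift (1 : ZMod p) (fun x => x ^ k) k 0
    rw [h1] at h2
    simpa using h2
  have : ((fun x => (fwdDiff x)^[k] P 0) - (k.factorial : ZMod p) • P)
      = ∑ j ∈ Finset.range (k + 1), (((-1) ^ (k - j) * (k.choose j) : ℤ) : ZMod p) •
          ((fun x => P (j • x)) - (j : ZMod p) ^ k • P) := by
    ext x
    rw [hfac]
    simp only [Pi.sub_apply, Pi.smul_apply, Finset.sum_apply, fwdDiff_iter_eq_sum_shift,
      zsmul_eq_mul, smul_eq_mul, zero_add, mul_sub, Finset.sum_sub_distrib, Finset.sum_mul]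
    simp only [mul_assoc]
  rw [this]
  exact PolyDegLT.sum fun j _ => (hP.comp_nsmul_sub j).smul _

/-- The iterated derivative `D_{t₀} ⋯ D_{t_{k-1}} P`. -/
def multiDiff : (k : ℕ) → (Fin k → V) → (V → ZMod p) → V → ZMod p
  | 0, _, P => P
  | k + 1, t, P => fwdDiff (t 0) (multiDiff k (Fin.tail t) P)

lemma multiDiff_succ' (k : ℕ) (t : Fin (k + 1) → V) (P : V → ZMod p) :
    multiDiff (k + 1) t P = multiDiff k (Fin.tail t) (fwdDiff (t 0) P) := by
  suffices H : ∀ (k : ℕ) (t : Fin k → V) (a : V),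
      fwdDiff a (multiDiff k t P) = multiDiff k t (fwdDiff a P) from H k _ _
  intro k
  induction k with
  | zero => intro t a; rfl
  | succ k ih =>
    intro t a
    rw [multiDiff, multiDiff, fwdDiff_comm', ih]

lemma multiDiff_const (k : ℕ) (x : V) (P : V → ZMod p) :
    multiDiff k (fun _ => x) P = (fwdDiff x)^[k] P := by
  induction k with
  | zero => rfl
  | succ k ih =>
    rw [Function.iterate_succ_apply', ← ih]
    rfl

lemma PolyDegLT.multiDiff_apply {m : ℕ} {P : V → ZMod p} (hP : PolyDegLT m P) (k : ℕ)
    (L : Fin k → W →+ V) (M : W →+ V) :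
    PolyDegLT m (fun w => multiDiff k (fun i => L i w) P (M w)) := by
  induction k generalizing M with
  | zero => exact hP.comp M
  | succ k ih => exact (ih (Fin.tail L) (M + L 0)).sub (ih (Fin.tail L) M)

end Polynomials

section Rank

variable {p : ℕ} {V W : Type} [AddCommGroup V] [AddCommGroup W]

/-- `P` is determined by at most `k` polynomials of degree less than `d`. -/
def RankLE (d k : ℕ) (P : V → ZMod p) : Prop :=
  ∃ s : Finset (V → ZMod p), s.card ≤ k ∧ (∀ Q ∈ s, PolyDegLT d Q) ∧
    ∀ x y, (∀ Q ∈ s, Q x = Q y) → P x = P y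

lemma RankLE.mono {d k l : ℕ} (hkl : k ≤ l) {P : V → ZMod p} (hP : RankLE d k P) :
    RankLE d l P := by
  obtain ⟨s, hs, h⟩ := hP
  exact ⟨s, hs.trans hkl, h⟩

lemma RankLE.add {d k : ℕ} {P Q : V → ZMod p} (hP : RankLE d k P) (hQ : PolyDegLT d Q) :
    RankLE d (k + 1) (P + Q) := by
  classical
  obtain ⟨s, hs, hd, h⟩ := hP
  refine ⟨insert Q s, (Finset.card_insert_le _ _).trans (by omega), ?_, fun x y hxy => ?_⟩
  · simpa [hQ] using hd
  · simp only [Finset.forall_mem_insert] at hxy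
    simp [hxy.1, h x y hxy.2]

lemma RankLE.smul {d k : ℕ} {P : V → ZMod p} (c : ZMod p) (hP : RankLE d k P) :
    RankLE d k (c • P) := by
  obtain ⟨s, hs, hd, h⟩ := hP
  exact ⟨s, hs, hd, fun x y hxy => by simp [h x y hxy]⟩

lemma RankLE.comp {d k : ℕ} {P : V → ZMod p} (hP : RankLE d k P) (φ : W →+ V) :
    RankLE d k (fun w => P (φ w)) := by
  classical
  obtain ⟨s, hs, hd, h⟩ := hP
  refine ⟨s.image fun Q w => Q (φ w), Finset.card_image_le.trans hs, ?_, fun x y hxy => ?_⟩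
  · simp only [Finset.forall_mem_image]
    exact fun Q hQ => (hd Q hQ).comp φ
  · simp only [Finset.forall_mem_image] at hxy
    exact h _ _ hxy

/-- A polynomial of degree `k < p` has bounded rank as soon as its symmetric `k`-linear form of
top derivatives does. -/
lemma RankLE.of_multiDiff {p : ℕ} [Fact p.Prime] {k r : ℕ} (hk : k < p) {P : V → ZMod p}
    (hP : PolyDegLT (k + 1) P)
    (h : RankLE k r (fun t : Fin k → V => multiDiff k t P 0)) : RankLE k (r + 1) P := by
  have h1 := h.comp (AddMonoidHom.mk' (fun x : V => fun _ : Fin k => x) (fun _ _ => rfl))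
  have h2 := (h1.add hP.iterate_fwdDiff_sub.neg).smul ((k.factorial : ZMod p)⁻¹)
  have h3 : (k.factorial : ZMod p) ≠ 0 := by
    rw [Ne, ZMod.natCast_eq_zero_iff, (Fact.out : p.Prime).dvd_factorial]
    omega
  convert h2 using 1
  ext x
  simp [multiDiff_const, h3]

end Rank

section Translation

variable {p n : ℕ}

lemma isPolyDegreeLE_iff {d : ℤ} {k : ℕ} (hk : (d + 1).toNat = k) {P : (Fin n → ZMod p) → ZMod p} :
    IsPolyDegreeLE d P ↔ PolyDegLT k P := by
  unfold IsPolyDegreeLE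
  rw [hk]
  clear hk
  induction k generalizing P with
  | zero => simp [polyDegLT_zero, iterAddDeriv]
  | succ k ih =>
    rw [polyDegLT_succ]
    simp only [← ih]
    constructor
    · intro H h hs hl
      have := H (hs ++ [h]) (by simp [hl])
      simpa [iterAddDeriv] using this
    · intro H hs hl
      obtain rfl | ⟨l, a, rfl⟩ := List.eq_nil_or_concat' hs
      · simp at hl
      simp only [List.length_append, List.length_singleton, Nat.add_right_cancel_iff] at hl
      have := H a l hl
      simpa [iterAddDeriv] using this

lemma RankLE.degreeRank_le {d k : ℕ} {P : (Fin n → ZMod p) → ZMod p} (hP : RankLE d k P) :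
    degreeRank ((d : ℤ) - 1) P ≤ k := by
  obtain ⟨s, hs, hd, h⟩ := hP
  have : IsFunctionOfPolys ((d : ℤ) - 1) s.card P := by
    have hfac : P.FactorsThrough (fun x => fun i => (s.equivFin.symm i : _ → ZMod p) x) := by
      intro x y hxy
      refine h x y fun Q hQ => ?_
      simpa using congrFun hxy (s.equivFin ⟨Q, hQ⟩)
    refine ⟨fun i => s.equivFin.symm i, Function.extend _ P 0, fun i => ?_,
      fun x => (hfac.extend_apply 0 x).symm⟩
    rw [isPolyDegreeLE_iff (k := d) (by simp)]
    exact hd _ (s.equivFin.symm i).2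
  exact (iInf₂_le s.card this).trans (Nat.cast_le.2 hs)

end Translation

section Regularity

variable {p : ℕ} {V : Type} [AddCommGroup V]

/-- A factor of degree less than `d`: a finite family of polynomials `q.2`, each labelled with a
strict degree bound `q.1 ≤ d`. -/
def IsFactor (d : ℕ) (s : Finset (ℕ × (V → ZMod p))) : Prop :=
  ∀ q ∈ s, q.1 ≤ d ∧ PolyDegLT q.1 q.2

/-- Two points lie in the same atom of a factor. -/
def SameAtom (s : Finset (ℕ × (V → ZMod p))) (x y : V) : Prop :=
  ∀ q ∈ s, q.2 x = q.2 y

/-- No nontrivial linear combination of the polynomials of the same degree `j` in the factor has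
degree `j - 1` rank at most `R`. -/
def RegularFactor (R : ℕ) (s : Finset (ℕ × (V → ZMod p))) : Prop :=
  ∀ (j : ℕ) (c : ℕ × (V → ZMod p) → ZMod p), (∃ q ∈ s, q.1 = j + 1 ∧ c q ≠ 0) →
    ¬ RankLE j R (∑ q ∈ s with q.1 = j + 1, c q • q.2)

lemma RegularFactor.anti {R R' : ℕ} (hR : R ≤ R')
    {s : Finset (ℕ × (V → ZMod p))} (hs : RegularFactor R' s) : RegularFactor R s :=
  fun j c hc h => hs j c hc (h.mono hR)

end Regularity

section RegularityLemma

variable {p : ℕ} [Fact p.Prime]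

lemma exists_regular_refinement_step {d : ℕ} {R : ℕ → ℕ} (hR : Monotone R)
    (ih : ∀ R : ℕ → ℕ, Monotone R → ∀ m, ∃ M, ∀ (V : Type) [AddCommGroup V]
      (s : Finset (ℕ × (V → ZMod p))), IsFactor d s → s.card ≤ m →
      ∃ s' : Finset (ℕ × (V → ZMod p)), IsFactor d s' ∧ s'.card ≤ M ∧ RegularFactor (R s'.card) s' ∧
        ∀ x y, SameAtom s' x y → SameAtom s x y) (a m : ℕ) :
    ∃ M, ∀ (V : Type) [AddCommGroup V] (s : Finset (ℕ × (V → ZMod p)))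
      (t : Finset (V → ZMod p)), IsFactor d s → s.card ≤ m →
      (∀ Q ∈ t, PolyDegLT (d + 1) Q) → t.card ≤ a →
      ∃ s' : Finset (ℕ × (V → ZMod p)), IsFactor (d + 1) s' ∧ s'.card ≤ M ∧ RegularFactor (R s'.card) s' ∧
        ∀ x y, SameAtom s' x y → SameAtom s x y ∧ ∀ Q ∈ t, Q x = Q y := by
  classical
  induction a generalizing m with
  | zero =>
    obtain ⟨M, hM⟩ := ih R hR m
    refine ⟨M, fun V _ s t hs hsm _ hta => ?_⟩
    obtain rfl : t = ∅ := by simpa using hta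
    obtain ⟨s', h1, h2, h3, h4⟩ := hM V s hs hsm
    exact ⟨s', fun q hq => ⟨(h1 q hq).1.trans d.le_succ, (h1 q hq).2⟩, h2, h3,
      fun x y hxy => ⟨h4 x y hxy, by simp⟩⟩
  | succ a iha =>
    obtain ⟨M₁, hM₁⟩ := ih (fun n => R (n + (a + 1)))
      (fun _ _ h => hR (Nat.add_le_add_right h _)) m
    obtain ⟨M₂, hM₂⟩ := iha (M₁ + R (M₁ + (a + 1)))
    refine ⟨max (M₁ + (a + 1)) M₂, fun V _ s t hs hsm ht hta => ?_⟩
    obtain ⟨s₁, hs₁, hs₁M, hreg, hdet⟩ := hM₁ V s hs hsm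
    by_cases H : ∃ c : (V → ZMod p) → ZMod p, (∃ Q ∈ t, c Q ≠ 0) ∧
        RankLE d (R (M₁ + (a + 1))) (∑ Q ∈ t, c Q • Q)
    · obtain ⟨c, ⟨Q₀, hQ₀, hc⟩, u, hu, hud, hudet⟩ := H
      obtain ⟨s', h1, h2, h3, h4⟩ := hM₂ V (s₁ ∪ u.image (Prod.mk d)) (t.erase Q₀)
        (fun q hq => by
          rcases Finset.mem_union.1 hq with hq | hq
          · exact hs₁ q hq
          · obtain ⟨Q, hQ, rfl⟩ := Finset.mem_image.1 hq
            exact ⟨le_rfl, hud Q hQ⟩)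
        ((Finset.card_union_le _ _).trans
          (Nat.add_le_add hs₁M (Finset.card_image_le.trans hu)))
        (fun Q hQ => ht Q (Finset.mem_of_mem_erase hQ))
        (by rw [Finset.card_erase_of_mem hQ₀]; omega)
      refine ⟨s', h1, h2.trans (le_max_right _ _), h3, fun x y hxy => ?_⟩
      obtain ⟨h5, h6⟩ := h4 x y hxy
      refine ⟨hdet x y fun q hq => h5 q (Finset.mem_union_left _ hq), ?_⟩
      have h7 := hudet x y fun Q hQ =>
        h5 (d, Q) (Finset.mem_union_right _ (Finset.mem_image_of_mem _ hQ))
      simp only [Finset.sum_apply, Pi.smul_apply, smul_eq_mul] at h7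
      rw [← Finset.add_sum_erase t _ hQ₀, ← Finset.add_sum_erase t (fun Q => c Q * Q y) hQ₀,
        Finset.sum_congr rfl fun Q hQ => by rw [h6 Q hQ], add_left_inj] at h7
      intro Q hQ
      by_cases hQQ : Q = Q₀
      · rw [hQQ]
        exact mul_left_cancel₀ hc h7
      · exact h6 Q (Finset.mem_erase.2 ⟨hQQ, hQ⟩)
    · push Not at H
      have hcard : (s₁ ∪ t.image (Prod.mk (d + 1))).card ≤ s₁.card + (a + 1) :=
        (Finset.card_union_le _ _).trans
          (Nat.add_le_add_left (Finset.card_image_le.trans hta) _)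
      have hcard' := hcard.trans (Nat.add_le_add_right hs₁M _)
      refine ⟨s₁ ∪ t.image (Prod.mk (d + 1)), fun q hq => ?_, hcard'.trans (le_max_left _ _),
        fun j c hjc hrank => ?_, fun x y hxy =>
          ⟨hdet x y fun q hq => hxy q (Finset.mem_union_left _ hq), fun Q hQ =>
            hxy (d + 1, Q) (Finset.mem_union_right _ (Finset.mem_image_of_mem _ hQ))⟩⟩
      · rcases Finset.mem_union.1 hq with hq | hq
        · exact ⟨(hs₁ q hq).1.trans d.le_succ, (hs₁ q hq).2⟩
        · obtain ⟨Q, hQ, rfl⟩ := Finset.mem_image.1 hq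
          exact ⟨le_rfl, ht Q hQ⟩
      · rw [Finset.filter_union] at hrank
        obtain ⟨q, hq, hqj, hcq⟩ := hjc
        by_cases hj : j = d
        · subst hj
          have hf : (s₁.filter fun q => q.1 = j + 1) = ∅ :=
            Finset.filter_eq_empty_iff.2 fun q hq => by have := (hs₁ q hq).1; omega
          have hg : ((t.image (Prod.mk (j + 1))).filter fun q => q.1 = j + 1)
              = t.image (Prod.mk (j + 1)) :=
            Finset.filter_true_of_mem fun q hq => by
              obtain ⟨Q, _, rfl⟩ := Finset.mem_image.1 hq
              rfl
          rw [hf, hg, Finset.empty_union,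
            Finset.sum_image fun _ _ _ _ h => (Prod.mk.inj h).2] at hrank
          refine H (fun Q => c (j + 1, Q)) ?_ (hrank.mono (hR hcard'))
          rcases Finset.mem_union.1 hq with hq | hq
          · have := (hs₁ q hq).1
            omega
          · obtain ⟨Q, hQ, rfl⟩ := Finset.mem_image.1 hq
            exact ⟨Q, hQ, hcq⟩
        · have hg : ((t.image (Prod.mk (d + 1))).filter fun q => q.1 = j + 1) = ∅ :=
            Finset.filter_eq_empty_iff.2 fun q hq => by
              obtain ⟨Q, _, rfl⟩ := Finset.mem_image.1 hq
              simp only [Nat.add_right_cancel_iff]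
              exact Ne.symm hj
          rw [hg, Finset.union_empty] at hrank
          refine hreg j c ⟨q, ?_, hqj, hcq⟩ (hrank.mono (hR hcard))
          rcases Finset.mem_union.1 hq with hq | hq
          · exact hq
          · obtain ⟨Q, _, rfl⟩ := Finset.mem_image.1 hq
            simp only [Nat.add_right_cancel_iff] at hqj
            exact absurd hqj.symm hj

/-- Every factor has a regular refinement of bounded size. -/
theorem exists_regular_refinement (d : ℕ) {R : ℕ → ℕ} (hR : Monotone R) (m : ℕ) :
    ∃ M, ∀ (V : Type) [AddCommGroup V] (s : Finset (ℕ × (V → ZMod p))), IsFactor d s →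
      s.card ≤ m → ∃ s' : Finset (ℕ × (V → ZMod p)), IsFactor d s' ∧ s'.card ≤ M ∧ RegularFactor (R s'.card) s' ∧
        ∀ x y, SameAtom s' x y → SameAtom s x y := by
  classical
  induction d generalizing R m with
  | zero =>
    refine ⟨m, fun V _ s hs hsm => ⟨s, hs, hsm, ?_, fun _ _ => id⟩⟩
    rintro j c ⟨q, hq, hqj, -⟩
    have := (hs q hq).1
    omega
  | succ d ih =>
    obtain ⟨M, hM⟩ := exists_regular_refinement_step hR (fun R hR m => ih hR m) m m
    refine ⟨M, fun V _ s hs hsm => ?_⟩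
    obtain ⟨s', h1, h2, h3, h4⟩ := hM V (s.filter fun q => q.1 ≤ d)
      ((s.filter fun q => q.1 = d + 1).image Prod.snd)
      (fun q hq => ⟨(Finset.mem_filter.1 hq).2, (hs q (Finset.mem_filter.1 hq).1).2⟩)
      ((Finset.card_filter_le _ _).trans hsm)
      (fun Q hQ => by
        obtain ⟨q, hq, rfl⟩ := Finset.mem_image.1 hQ
        obtain ⟨hq, hqd⟩ := Finset.mem_filter.1 hq
        exact hqd ▸ (hs q hq).2)
      (Finset.card_image_le.trans ((Finset.card_filter_le _ _).trans hsm))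
    refine ⟨s', h1, h2, h3, fun x y hxy q hq => ?_⟩
    obtain ⟨h5, h6⟩ := h4 x y hxy
    have := (hs q hq).1
    by_cases hqd : q.1 = d + 1
    · exact h6 _ (Finset.mem_image_of_mem _ (Finset.mem_filter.2 ⟨hq, hqd⟩))
    · exact h5 q (Finset.mem_filter.2 ⟨hq, by omega⟩)

end RegularityLemma

section ExponentialSums

variable {p : ℕ} [Fact p.Prime] {X Y : Type*} [Fintype X] [Fintype Y]

/-- The normalized exponential sum `𝔼 x, e(g x)`. -/
noncomputable def expSum (g : X → ZMod p) : ℂ :=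
  𝔼 x, (ZMod.stdAddChar (g x) : ℂ)

lemma norm_stdAddChar (a : ZMod p) : ‖(ZMod.stdAddChar a : ℂ)‖ = 1 :=
  AddChar.norm_apply _ _

lemma expSum_const [Nonempty X] (a : ZMod p) :
    expSum (fun _ : X => a) = ZMod.stdAddChar a :=
  Fintype.expect_const _

lemma expSum_equiv (e : X ≃ Y) (g : Y → ZMod p) : expSum (fun x => g (e x)) = expSum g :=
  Fintype.expect_equiv e _ _ fun _ => rfl

lemma sq_expect_le_expect_sq [Nonempty X] (f : X → ℝ) : (𝔼 x, f x) ^ 2 ≤ 𝔼 x, f x ^ 2 := by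
  simpa using Finset.expect_mul_sq_le_sq_mul_sq Finset.univ f 1

lemma expect_pow_le_expect_pow [Nonempty X] {f : X → ℝ} (hf : ∀ x, 0 ≤ f x) (n : ℕ) :
    (𝔼 x, f x) ^ (2 ^ n) ≤ 𝔼 x, f x ^ (2 ^ n) := by
  induction n with
  | zero => simp
  | succ n ih =>
    rw [pow_succ, pow_mul]
    simp only [pow_mul]
    exact (pow_le_pow_left₀ (pow_nonneg (Finset.expect_nonneg fun x _ => hf x) _) ih 2).trans
      (sq_expect_le_expect_sq _)

lemma expect_fin_succ (k : ℕ) (f : (Fin (k + 1) → X) → ℂ) :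
    𝔼 t, f t = 𝔼 v, 𝔼 t : Fin k → X, f (Fin.cons v t) := by
  rw [← Finset.expect_product', Finset.univ_product_univ]
  exact (Fintype.expect_equiv (Fin.consEquiv fun _ => X) _ _ fun _ => rfl).symm

end ExponentialSums

section GowersNorm

variable {p : ℕ} [Fact p.Prime] {V : Type} [AddCommGroup V] [Fintype V]

lemma expSum_translate (g : V → ZMod p) (a : V) : expSum (fun x => g (a + x)) = expSum g :=
  expSum_equiv (Equiv.addLeft a) g

lemma norm_expSum_sq (G : V → ZMod p) :
    ((‖expSum G‖ ^ 2 : ℝ) : ℂ) = 𝔼 t, expSum (fwdDiff t G) := by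
  have hconj : (starRingEnd ℂ) (expSum G) = 𝔼 x, (ZMod.stdAddChar (-G x) : ℂ) := by
    rw [expSum, map_expect]
    simp only [AddChar.map_neg_eq_conj]
  rw [Complex.ofReal_pow, ← Complex.conj_mul', hconj, expSum, Finset.expect_mul]
  simp only [expSum]
  rw [Finset.expect_comm]
  refine Finset.expect_congr rfl fun x _ => ?_
  rw [Finset.mul_expect]
  refine (Fintype.expect_equiv (Equiv.addLeft x) _ _ fun t => ?_).symm
  rw [← AddChar.map_add_eq_mul, fwdDiff]
  congr 1
  simp only [Equiv.coe_addLeft]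
  ring

/-- `gowers k G` is the `2 ^ (k + 1)`-th power of the Gowers `U^{k + 1}` norm of `e(G)`. -/
noncomputable def gowers : ℕ → (V → ZMod p) → ℝ
  | 0, G => ‖expSum G‖ ^ 2
  | k + 1, G => 𝔼 t, gowers k (fwdDiff t G)

lemma gowers_nonneg (k : ℕ) (G : V → ZMod p) : 0 ≤ gowers k G := by
  induction k generalizing G with
  | zero => exact sq_nonneg _
  | succ k ih => exact Finset.expect_nonneg fun t _ => ih _

lemma gowers_sq_le (k : ℕ) (G : V → ZMod p) : gowers k G ^ 2 ≤ gowers (k + 1) G := by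
  induction k generalizing G with
  | zero =>
    have h : gowers 0 G ≤ 𝔼 t, ‖expSum (fwdDiff t G)‖ := by
      have := congrArg norm (norm_expSum_sq G)
      rw [Complex.norm_of_nonneg (sq_nonneg _)] at this
      exact this.trans_le (RCLike.norm_expect_le (K := ℂ))
    exact (pow_le_pow_left₀ (gowers_nonneg _ _) h 2).trans (sq_expect_le_expect_sq _)
  | succ k ih =>
    exact (sq_expect_le_expect_sq _).trans (Finset.expect_le_expect fun t _ => ih _)

lemma gowers_pow_le (k m : ℕ) (G : V → ZMod p) : gowers k G ^ 2 ^ m ≤ gowers (k + m) G := by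
  induction m with
  | zero => simp
  | succ m ih =>
    rw [pow_succ, pow_mul]
    exact (pow_le_pow_left₀ (pow_nonneg (gowers_nonneg _ _) _) ih 2).trans (gowers_sq_le _ _)

lemma gowers_eq_expSum {k : ℕ} {G : V → ZMod p} (hG : PolyDegLT (k + 2) G) :
    (gowers k G : ℂ) = expSum fun t : Fin (k + 1) → V => multiDiff (k + 1) t G 0 := by
  induction k generalizing G with
  | zero =>
    rw [gowers, norm_expSum_sq, expSum, expect_fin_succ]
    refine Finset.expect_congr rfl fun v _ => ?_
    have : fwdDiff v G = fun _ => fwdDiff v G 0 := by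
      ext x
      have := congrFun (hG v x) 0
      simp only [fwdDiff, zero_add, Pi.zero_apply] at this ⊢
      exact sub_eq_zero.1 this
    rw [this, expSum_const]
    exact (Fintype.expect_const _).symm
  | succ k ih =>
    rw [gowers, expSum, expect_fin_succ, Complex.ofReal_expect]
    refine Finset.expect_congr rfl fun v _ => ?_
    rw [ih (hG v), expSum]
    refine Finset.expect_congr rfl fun t _ => ?_
    rw [multiDiff_succ' (k + 1)]
    rfl

end GowersNorm

section BoxNorm

variable {p : ℕ} [Fact p.Prime] {V : Type} [AddCommGroup V] [Fintype V]
  {K : Type*} [Fintype K] [DecidableEq K]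

lemma expect_update {M : Type*} [AddCommMonoid M] [Module ℚ≥0 M] (i : K) (f : (K → V) → M) :
    𝔼 h, f h = 𝔼 h, 𝔼 v, f (Function.update h i v) := by
  have h1 : ∀ h : K → V, 𝔼 v, f (Function.update h i v) = 𝔼 v, f (h + (Pi.single i v : K → V)) := by
    intro h
    refine (Fintype.expect_equiv (Equiv.addLeft (h i)) _ _ fun v => ?_).symm
    congr 1
    ext j
    by_cases hj : j = i
    · subst hj; simp
    · simp [hj]
  simp only [h1]
  rw [Finset.expect_comm]
  rw [← Fintype.expect_const (ι := V) (𝔼 h, f h)]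
  refine Finset.expect_congr rfl fun v _ => ?_
  exact (Fintype.expect_equiv (Equiv.addRight (Pi.single i v : K → V)) _ _ fun _ => rfl).symm

lemma norm_expSum_add_le (i : K) {g Φ : (K → V) → ZMod p}
    (hg : ∀ h v, g (Function.update h i v) = g h) :
    ‖expSum (g + Φ)‖ ≤ 𝔼 h, ‖expSum fun v => Φ (Function.update h i v)‖ := by
  rw [expSum, expect_update i]
  refine (RCLike.norm_expect_le (K := ℂ)).trans (Finset.expect_le_expect fun h _ => ?_)
  simp only [Pi.add_apply, hg, AddChar.map_add_eq_mul]
  rw [← Finset.mul_expect, norm_mul, norm_stdAddChar, one_mul]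
  rfl

lemma norm_expSum_add_sq_le (i : K) {g Φ : (K → V) → ZMod p}
    (hg : ∀ h v, g (Function.update h i v) = g h) :
    ‖expSum (g + Φ)‖ ^ 2 ≤ 𝔼 t, 𝔼 v, ‖expSum fun h =>
      Φ (Function.update h i (v + t)) - Φ (Function.update h i v)‖ := by
  refine (pow_le_pow_left₀ (norm_nonneg _) (norm_expSum_add_le i hg) 2).trans
    ((sq_expect_le_expect_sq _).trans ?_)
  have h1 : (((𝔼 h : K → V, ‖expSum fun v => Φ (Function.update h i v)‖ ^ 2) : ℝ) : ℂ)
      = 𝔼 t, 𝔼 v, expSum fun h =>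
        Φ (Function.update h i (v + t)) - Φ (Function.update h i v) := by
    rw [Complex.ofReal_expect]
    simp only [norm_expSum_sq]
    rw [Finset.expect_comm]
    refine Finset.expect_congr rfl fun t _ => ?_
    simp only [expSum]
    rw [Finset.expect_comm]
    rfl
  have h2 := congrArg norm h1
  rw [Complex.norm_of_nonneg (Finset.expect_nonneg fun _ _ => sq_nonneg _)] at h2
  rw [h2]
  exact (RCLike.norm_expect_le (K := ℂ)).trans
    (Finset.expect_le_expect fun t _ => RCLike.norm_expect_le (K := ℂ))

/-- The Gowers–Cauchy–Schwarz inequality for a phase perturbed by functions which each ignore one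
of the variables. -/
lemma norm_expSum_pow_le_gowers {k : ℕ} {S : Finset K} (hS : S.card = k + 1) (G : V → ZMod p)
    (x : V) (g : K → (K → V) → ZMod p)
    (hg : ∀ i ∈ S, ∀ h v, g i (Function.update h i v) = g i h) :
    ‖expSum fun h : K → V => G (x + ∑ i ∈ S, h i) + ∑ i ∈ S, g i h‖ ^ 2 ^ (k + 1)
      ≤ gowers k G := by
  induction k generalizing S G x g with
  | zero =>
    obtain ⟨i, rfl⟩ := Finset.card_eq_one.1 hS
    have h1 := norm_expSum_add_le i (Φ := fun h => G (x + h i)) (hg i (by simp))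
    simp only [Function.update_self, expSum_translate, Fintype.expect_const] at h1
    have h2 : (fun h : K → V => G (x + ∑ i ∈ {i}, h i) + ∑ i ∈ {i}, g i h)
        = g i + fun h => G (x + h i) := by
      ext h; simp [add_comm]
    rw [h2]
    simpa [gowers] using pow_le_pow_left₀ (norm_nonneg _) h1 2
  | succ k ih =>
    obtain ⟨i, T, hiT, rfl, hT⟩ := Finset.card_eq_succ.1 hS
    have hne : ∀ j ∈ T, j ≠ i := fun j hj h => hiT (h ▸ hj)
    set Φ : (K → V) → ZMod p := fun h => G (x + ∑ i ∈ insert i T, h i) + ∑ i ∈ T, g i h with hΦ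
    have h2 : (fun h : K → V => G (x + ∑ i ∈ insert i T, h i) + ∑ i ∈ insert i T, g i h)
        = g i + Φ := by
      ext h
      rw [Finset.sum_insert (f := fun i => g i h) hiT, Pi.add_apply, hΦ]
      ring
    have h3 : ∀ t v, (fun h => Φ (Function.update h i (v + t)) - Φ (Function.update h i v))
        = fun h => fwdDiff t G ((x + v) + ∑ i ∈ T, h i) + ∑ j ∈ T,
          (g j (Function.update h i (v + t)) - g j (Function.update h i v)) := by
      intro t v
      ext h
      have h4 : ∀ w, ∑ j ∈ insert i T, Function.update h i w j = w + ∑ j ∈ T, h j := by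
        intro w
        rw [Finset.sum_insert hiT, Function.update_self]
        congr 1
        exact Finset.sum_congr rfl fun j hj => Function.update_of_ne (hne j hj) _ _
      simp only [hΦ, h4, fwdDiff, Finset.sum_sub_distrib]
      rw [show x + (v + t + ∑ j ∈ T, h j) = x + v + ∑ j ∈ T, h j + t by abel,
        show x + (v + ∑ j ∈ T, h j) = x + v + ∑ j ∈ T, h j by abel]
      ring
    have h5 := norm_expSum_add_sq_le i (Φ := Φ) (hg i (Finset.mem_insert_self _ _))
    simp only [h3] at h5
    rw [h2, pow_succ' 2, pow_mul]
    refine (pow_le_pow_left₀ (sq_nonneg _) h5 _).trans ?_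
    refine (expect_pow_le_expect_pow (fun t => Finset.expect_nonneg fun v _ => norm_nonneg _)
      _).trans (Finset.expect_le_expect fun t _ => ?_)
    refine (expect_pow_le_expect_pow (fun v => norm_nonneg _) _).trans
      (Finset.expect_le Finset.univ_nonempty fun v _ => ?_)
    refine ih hT (fwdDiff t G) (x + v)
      (fun j h => g j (Function.update h i (v + t)) - g j (Function.update h i v))
      fun j hj h w => ?_
    simp only [Function.update_comm (hne j hj), hg j (Finset.mem_insert_of_mem hj)]

lemma norm_expSum_cube_pow_le_gowers {k : ℕ} {S : Finset K} (hS : S.card = k + 1)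
    (G : Finset K → V → ZMod p) (hG : ∀ T ≠ S, G T ≠ 0 → ¬ S ⊆ T) (x : V) :
    ‖expSum fun h : K → V => ∑ T, G T (x + ∑ i ∈ T, h i)‖ ^ 2 ^ (k + 1)
      ≤ gowers k (G S) := by
  have hne : S.Nonempty := Finset.card_pos.1 (by omega)
  have h1 : ∀ T ≠ S, ∃ i ∈ S, ∀ (h : K → V) v,
      G T (x + ∑ j ∈ T, Function.update h i v j) = G T (x + ∑ j ∈ T, h j) := by
    intro T hT
    by_cases h0 : G T = 0
    · exact ⟨hne.choose, hne.choose_spec, fun h v => by simp [h0]⟩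
    · obtain ⟨i, hiS, hiT⟩ := Finset.not_subset.1 (hG T hT h0)
      refine ⟨i, hiS, fun h v => ?_⟩
      congr 2
      exact Finset.sum_congr rfl fun j hj =>
        Function.update_of_ne (by rintro rfl; exact hiT hj) _ _
  have : Nonempty K := ⟨hne.choose⟩
  choose! i hiS hi using h1
  have h2 := norm_expSum_pow_le_gowers hS (G S) x
    (fun j h => ∑ T ∈ (Finset.univ.erase S).filter (fun T => i T = j), G T (x + ∑ i ∈ T, h i))
    (fun j _ h v => Finset.sum_congr rfl fun T hT => by
      obtain ⟨hT₁, rfl⟩ := Finset.mem_filter.1 hT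
      exact hi T (Finset.ne_of_mem_erase hT₁) h v)
  convert h2 using 4
  ext h
  rw [Finset.sum_fiberwise_of_maps_to fun T hT => hiS T (Finset.ne_of_mem_erase hT),
    Finset.add_sum_erase _ (fun T => G T (x + ∑ i ∈ T, h i)) (Finset.mem_univ S)]

end BoxNorm

section Equidistribution

variable {p : ℕ} [Fact p.Prime]

/-- Biased polynomials of degree at most `k` have bounded degree `k - 1` rank. -/
def BiasImpliesRank (p : ℕ) [Fact p.Prime] (k : ℕ) : Prop :=
  ∀ δ : ℝ, 0 < δ → ∃ C, ∀ (V : Type) [AddCommGroup V] [Fintype V] (P : V → ZMod p),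
    PolyDegLT (k + 1) P → δ ≤ ‖expSum P‖ → RankLE k C P

lemma BiasImpliesRank.of_gowers {k : ℕ} (h : BiasImpliesRank p (k + 1)) (hk : k + 1 < p) {ε : ℝ}
    (hε : 0 < ε) : ∃ C, ∀ (V : Type) [AddCommGroup V] [Fintype V] (G : V → ZMod p),
    PolyDegLT (k + 2) G → ε ≤ gowers k G → RankLE (k + 1) C G := by
  obtain ⟨C, hC⟩ := h ε hε
  refine ⟨C + 1, fun V _ _ G hG hεG => RankLE.of_multiDiff hk hG (hC _ _ ?_ ?_)⟩
  · exact hG.multiDiff_apply (k + 1) (fun i => Pi.evalAddMonoidHom _ i) 0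
  · rw [← gowers_eq_expSum hG, Complex.norm_of_nonneg (gowers_nonneg _ _)]
    exact hεG

lemma exists_cube_bound {d : ℕ} (hd : d ≤ p) (h : ∀ k < d, BiasImpliesRank p k) {ε : ℝ}
    (hε : 0 < ε) (hε1 : ε ≤ 1) :
    ∃ R, ∀ (V : Type) [AddCommGroup V] [Fintype V] (s : Finset (ℕ × (V → ZMod p))),
      IsFactor d s → RegularFactor R s → ∀ (K : Type) [Fintype K] [DecidableEq K]
        (c : ℕ × (V → ZMod p) → Finset K → ZMod p),
        (∀ q ∈ s, ∀ T, c q T ≠ 0 → T.card < q.1) → (∃ q ∈ s, ∃ T ≠ ∅, c q T ≠ 0) →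
        ∀ x, ‖expSum fun h : K → V => ∑ q ∈ s, ∑ T, c q T * q.2 (x + ∑ i ∈ T, h i)‖ < ε := by
  classical
  have h1 : ∀ k, ∃ C, k + 2 ≤ d → ∀ (V : Type) [AddCommGroup V] [Fintype V] (G : V → ZMod p),
      PolyDegLT (k + 2) G → ε ^ 2 ^ d ≤ gowers k G → RankLE (k + 1) C G := by
    intro k
    by_cases hk : k + 2 ≤ d
    · obtain ⟨C, hC⟩ := (h (k + 1) (by omega)).of_gowers (by omega) (pow_pos hε (2 ^ d))
      exact ⟨C, fun _ => hC⟩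
    · exact ⟨0, fun h => absurd h hk⟩
  choose C hC using h1
  refine ⟨(Finset.range d).sup C + 1, fun V _ _ s hs hreg K _ _ c hred hne x => ?_⟩
  by_contra! hlarge
  obtain ⟨q₁, hq₁, T₁, hT₁, hc₁⟩ := hne
  obtain ⟨S, hSmem, hSmax⟩ := Finset.exists_max_image
    (Finset.univ.filter fun T : Finset K => ∃ q ∈ s, c q T ≠ 0) Finset.card
    ⟨T₁, Finset.mem_filter.2 ⟨Finset.mem_univ _, q₁, hq₁, hc₁⟩⟩
  simp only [Finset.mem_filter, Finset.mem_univ, true_and] at hSmem hSmax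
  have hScard : 0 < S.card :=
    (Finset.card_pos.2 (Finset.nonempty_iff_ne_empty.2 hT₁)).trans_le (hSmax T₁ ⟨q₁, hq₁, hc₁⟩)
  obtain ⟨k₀, hk₀⟩ : ∃ k₀, S.card = k₀ + 1 := ⟨S.card - 1, by omega⟩
  obtain ⟨q₀, hq₀mem, hq₀max⟩ := Finset.exists_max_image (s.filter fun q => c q S ≠ 0) Prod.fst
    (by obtain ⟨q, hq, hcq⟩ := hSmem; exact ⟨q, Finset.mem_filter.2 ⟨hq, hcq⟩⟩)
  simp only [Finset.mem_filter] at hq₀mem hq₀max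
  have hq₀S := hred q₀ hq₀mem.1 S hq₀mem.2
  obtain ⟨m, hm⟩ : ∃ m, q₀.1 = k₀ + m + 2 := ⟨q₀.1 - k₀ - 2, by omega⟩
  have hq₀d := (hs q₀ hq₀mem.1).1
  set G : Finset K → V → ZMod p := fun T => ∑ q ∈ s, c q T • q.2 with hGdef
  have hGdeg : PolyDegLT (k₀ + m + 2) (G S) := by
    refine PolyDegLT.sum fun q hq => ?_
    by_cases hcq : c q S = 0
    · rw [hcq, zero_smul]
      exact PolyDegLT.zero _
    · exact ((hs q hq).2.mono (hm ▸ hq₀max q ⟨hq, hcq⟩)).smul _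
  have h2 := norm_expSum_cube_pow_le_gowers hk₀ G (fun T hTS hT hST => hTS ?_) x
  swap
  · refine (Finset.eq_of_subset_of_card_le hST (hSmax T ?_)).symm
    by_contra! hT'
    exact hT (Finset.sum_eq_zero fun q hq => by rw [hT' q hq, zero_smul])
  have h3 : (fun h : K → V => ∑ q ∈ s, ∑ T, c q T * q.2 (x + ∑ i ∈ T, h i))
      = fun h : K → V => ∑ T, G T (x + ∑ i ∈ T, h i) := by
    ext h
    rw [Finset.sum_comm]
    simp [hGdef]
  rw [h3] at hlarge
  have h4 : ε ^ 2 ^ d ≤ gowers (k₀ + m) (G S) := by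
    refine le_trans ?_ (gowers_pow_le k₀ m (G S))
    refine le_trans ?_ (pow_le_pow_left₀ (by positivity)
      ((pow_le_pow_left₀ hε.le hlarge _).trans h2) _)
    rw [← pow_mul, ← pow_add]
    exact pow_le_pow_of_le_one hε.le hε1 (Nat.pow_le_pow_right two_pos (by omega))
  have h5 := hC (k₀ + m) (by omega) V (G S) hGdeg h4
  have h6 : PolyDegLT (k₀ + m + 1) (-∑ q ∈ s with ¬ q.1 = k₀ + m + 1 + 1, c q S • q.2) := by
    refine (PolyDegLT.sum fun q hq => ?_).neg
    rw [Finset.mem_filter] at hq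
    by_cases hcq : c q S = 0
    · rw [hcq, zero_smul]
      exact PolyDegLT.zero _
    · have := hq₀max q ⟨hq.1, hcq⟩
      exact ((hs q hq.1).2.mono (by omega)).smul _
  refine hreg (k₀ + m + 1) (fun q => c q S) ⟨q₀, hq₀mem.1, hm, hq₀mem.2⟩ ?_
  have h7 := (h5.add h6).mono (Nat.add_le_add_right
    (Finset.le_sup (f := C) (Finset.mem_range.2 (show k₀ + m < d by omega))) 1)
  convert h7 using 1
  rw [eq_add_neg_iff_add_eq]
  exact Finset.sum_filter_add_sum_filter_not s _ _

/-- The value of a polynomial of degree less than `k` at a vertex of a cube is a fixed linear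
combination of its values at the vertices in the `k - 1` lowest layers. -/
lemma exists_cube_coeff {V : Type} [AddCommGroup V] {K : Type*} [Fintype K] [DecidableEq K]
    (k : ℕ) (T : Finset K) :
    ∃ c : Finset K → ZMod p, (∀ S, c S ≠ 0 → S.card < k) ∧
      ∀ Q : V → ZMod p, PolyDegLT k Q → ∀ (x : V) (h : K → V),
        Q (x + ∑ i ∈ T, h i) = ∑ S, c S * Q (x + ∑ i ∈ S, h i) := by
  induction T using Finset.strongInduction with
  | H T ih =>
    by_cases hT : T.card < k
    · refine ⟨Pi.single T 1, fun S hS => ?_, fun Q _ x h => ?_⟩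
      · by_cases hST : S = T
        · exact hST ▸ hT
        · exact absurd (Pi.single_eq_of_ne hST _) hS
      · simp [Pi.single_apply]
    · choose! c hc hQc using ih
      refine ⟨-∑ S ∈ T.ssubsets, (-1) ^ (S.card + T.card) • c S, fun S hS => ?_,
        fun Q hQ x h => ?_⟩
      · by_contra hSk
        refine hS ?_
        rw [Pi.neg_apply, Finset.sum_apply, neg_eq_zero]
        refine Finset.sum_eq_zero fun S' hS' => ?_
        by_contra hne
        exact hSk (hc S' (Finset.mem_ssubsets.1 hS') S fun h0 => hne (by simp [h0]))
      · have h1 := hQ.sum_cube_eq_zero T (not_lt.1 hT) x h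
        rw [← Finset.insert_erase (Finset.mem_powerset_self T),
          Finset.sum_insert (Finset.notMem_erase _ _)] at h1
        have h2 : (-1 : ZMod p) ^ T.card * (-1) ^ T.card = 1 := by
          rw [← mul_pow]; simp
        have h3 : Q (x + ∑ i ∈ T, h i)
            = -∑ S ∈ T.ssubsets, (-1) ^ (S.card + T.card) * Q (x + ∑ i ∈ S, h i) := by
          rw [eq_neg_iff_add_eq_zero, ← mul_right_inj' (left_ne_zero_of_mul_eq_one h2),
            mul_zero, ← h1, mul_add, Finset.mul_sum]
          congr 1
          refine Finset.sum_congr rfl fun S _ => ?_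
          rw [pow_add, ← mul_assoc, mul_left_comm, h2, mul_one]
        rw [h3]
        simp only [Pi.neg_apply, Finset.sum_apply, neg_mul, Finset.sum_neg_distrib, neg_inj,
          Finset.sum_mul]
        rw [Finset.sum_comm]
        refine Finset.sum_congr rfl fun S hS => ?_
        rw [hQc S (Finset.mem_ssubsets.1 hS) Q hQ x h, Finset.mul_sum]
        simp [mul_assoc]

/-- Over a sufficiently regular factor, the distribution of the atoms of the vertices of a random
cube based at `x` nearly depends on the atom of `x` only. -/
lemma exists_cube_close {d : ℕ} (hd : d ≤ p) (h : ∀ k < d, BiasImpliesRank p k) {ε : ℝ}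
    (hε : 0 < ε) (hε1 : ε ≤ 1) :
    ∃ R, ∀ (V : Type) [AddCommGroup V] [Fintype V] (s : Finset (ℕ × (V → ZMod p))),
      IsFactor d s → RegularFactor R s → ∀ (K : Type) [Fintype K] [DecidableEq K]
        (c : ℕ × (V → ZMod p) → Finset K → ZMod p) (x y : V), SameAtom s x y →
        ‖(expSum fun h : K → V => ∑ q ∈ s, ∑ T, c q T * q.2 (x + ∑ i ∈ T, h i))
          - expSum fun h : K → V => ∑ q ∈ s, ∑ T, c q T * q.2 (y + ∑ i ∈ T, h i)‖ ≤ 2 * ε := by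
  obtain ⟨R, hR⟩ := exists_cube_bound hd h hε hε1
  refine ⟨R, fun V _ _ s hs hreg K _ _ c x y hxy => ?_⟩
  choose a ha hQa using fun k => exists_cube_coeff (p := p) (V := V) (K := K) k
  set c' : ℕ × (V → ZMod p) → Finset K → ZMod p := fun q S => ∑ T, c q T * a q.1 T S with hc'
  have h1 : ∀ z, (fun h : K → V => ∑ q ∈ s, ∑ T, c q T * q.2 (z + ∑ i ∈ T, h i))
      = fun h : K → V => ∑ q ∈ s, ∑ T, c' q T * q.2 (z + ∑ i ∈ T, h i) := by
    intro z
    ext h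
    refine Finset.sum_congr rfl fun q hq => ?_
    simp only [hc', Finset.sum_mul]
    rw [Finset.sum_comm]
    refine Finset.sum_congr rfl fun T _ => ?_
    rw [hQa q.1 T q.2 (hs q hq).2 z h, Finset.mul_sum]
    simp only [mul_assoc]
  have hred : ∀ q ∈ s, ∀ T, c' q T ≠ 0 → T.card < q.1 := by
    intro q _ T hT
    obtain ⟨S, _, hS⟩ := Finset.exists_ne_zero_of_sum_ne_zero hT
    exact ha q.1 S T (right_ne_zero_of_mul hS)
  rw [h1, h1]
  by_cases hne : ∃ q ∈ s, ∃ T ≠ ∅, c' q T ≠ 0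
  · refine (norm_sub_le _ _).trans ?_
    have h2 := hR V s hs hreg K c' hred hne x
    have h3 := hR V s hs hreg K c' hred hne y
    linarith
  · push Not at hne
    have h2 : ∀ z (h : K → V), ∑ q ∈ s, ∑ T, c' q T * q.2 (z + ∑ i ∈ T, h i)
        = ∑ q ∈ s, c' q ∅ * q.2 z := by
      intro z h
      refine Finset.sum_congr rfl fun q hq => ?_
      rw [Finset.sum_eq_single ∅ (fun T _ hT => by rw [hne q hq T (Finset.nonempty_iff_ne_empty.2 hT), zero_mul]) (by simp)]
      simp
    have h3 : ∑ q ∈ s, c' q ∅ * q.2 x = ∑ q ∈ s, c' q ∅ * q.2 y :=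
      Finset.sum_congr rfl fun q hq => by rw [hxy q hq]
    simp only [h2, h3, sub_self, norm_zero]
    positivity

end Equidistribution

section Distribution

variable {p : ℕ} [Fact p.Prime] {I : Type*} [Fintype I]

lemma expSum_dot_eq_ite [DecidableEq I] (z : I → ZMod p) :
    (expSum fun c : I → ZMod p => ∑ i, c i * z i) = if z = 0 then 1 else 0 := by
  classical
  let φ : (I → ZMod p) →+ ZMod p := AddMonoidHom.mk' (fun c => ∑ i, c i * z i)
    fun a b => by simp [add_mul, Finset.sum_add_distrib]
  let ψ : AddChar (I → ZMod p) ℂ := (ZMod.stdAddChar (N := p)).compAddMonoidHom φ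
  have h1 : (expSum fun c : I → ZMod p => ∑ i, c i * z i) = 𝔼 c, ψ c := rfl
  have h2 : ψ = 0 ↔ z = 0 := by
    constructor
    · intro h
      ext i
      have h3 : ZMod.stdAddChar (N := p) (φ (Pi.single i 1)) = 1 := DFunLike.congr_fun h _
      have h4 : φ (Pi.single i 1) = z i := by simp [φ, Pi.single_apply]
      rw [h4] at h3
      exact ZMod.injective_stdAddChar (h3.trans (AddChar.map_zero_eq_one _).symm)
    · rintro rfl
      ext c
      simp [ψ, φ]
  rw [h1, AddChar.expect_eq_ite]
  simp only [h2]

lemma expect_eq_ite_fourier {Z : Type*} [Fintype Z] [DecidableEq I] (f : Z → I → ZMod p)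
    (w : I → ZMod p) :
    (((𝔼 z, if f z = w then (1 : ℝ) else 0) : ℝ) : ℂ)
      = 𝔼 c : I → ZMod p, (ZMod.stdAddChar (-∑ i, c i * w i) : ℂ)
        * expSum fun z => ∑ i, c i * f z i := by
  simp only [expSum, Finset.mul_expect]
  rw [Finset.expect_comm, Complex.ofReal_expect]
  refine Finset.expect_congr rfl fun z _ => ?_
  have h1 := expSum_dot_eq_ite (f z - w)
  rw [expSum] at h1
  simp only [sub_eq_zero] at h1
  rw [apply_ite Complex.ofReal, Complex.ofReal_one, Complex.ofReal_zero, ← h1]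
  refine Finset.expect_congr rfl fun c _ => ?_
  rw [← AddChar.map_add_eq_mul]
  congr 1
  simp only [Pi.sub_apply, mul_sub, Finset.sum_sub_distrib]
  ring

/-- Two random vectors over `𝔽` with close characteristic functions coincide somewhere, even when
sets of small density are avoided. -/
lemma exists_eq_of_expSum_close {X Y : Type*} [Fintype X] [Fintype Y] [Nonempty X] [Nonempty Y]
    [DecidableEq I] {u : X → I → ZMod p} {v : Y → I → ZMod p} {η : ℝ}
    (hη : Fintype.card (I → ZMod p) * η < 1 / 2)
    (hclose : ∀ c : I → ZMod p,
      ‖(expSum fun x => ∑ i, c i * u x i) - expSum fun y => ∑ i, c i * v y i‖ ≤ η)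
    {b : X → ℝ} {b' : Y → ℝ} (hb : ∀ x, 0 ≤ b x) (hb' : ∀ y, 0 ≤ b' y)
    (hbE : 𝔼 x, b x ≤ 1 / 4) (hbE' : 𝔼 y, b' y ≤ 1 / 4) :
    ∃ x y, b x < 1 ∧ b' y < 1 ∧ u x = v y := by
  classical
  by_contra! hcon
  have hη0 : 0 ≤ η := (norm_nonneg _).trans (hclose 0)
  set W : Finset (I → ZMod p) := (Finset.univ.filter fun x => b x < 1).image u with hW
  have h1 : ∀ w, (𝔼 x, if u x = w then (1 : ℝ) else 0) - (𝔼 y, if v y = w then (1 : ℝ) else 0)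
      ≤ η := by
    intro w
    refine (le_abs_self _).trans ?_
    rw [← Real.norm_eq_abs, ← Complex.norm_real, Complex.ofReal_sub, expect_eq_ite_fourier,
      expect_eq_ite_fourier, ← Finset.expect_sub_distrib]
    refine (RCLike.norm_expect_le (K := ℂ)).trans
      (Finset.expect_le Finset.univ_nonempty fun c _ => ?_)
    rw [← mul_sub, norm_mul, norm_stdAddChar, one_mul]
    exact hclose c
  have h2 : 3 / 4 ≤ ∑ w ∈ W, 𝔼 x, if u x = w then (1 : ℝ) else 0 := by
    rw [← Finset.expect_sum_comm]
    have h3 : 𝔼 x, (1 - b x) ≤ 𝔼 x, ∑ w ∈ W, if u x = w then (1 : ℝ) else 0 := by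
      refine Finset.expect_le_expect fun x _ => ?_
      rw [Finset.sum_ite_eq]
      split_ifs with hx
      · linarith [hb x]
      · by_contra! hbx
        exact hx (Finset.mem_image_of_mem _ (by simpa using hbx))
    rw [Finset.expect_sub_distrib, Fintype.expect_const] at h3
    linarith
  have h3 : ∑ w ∈ W, 𝔼 y, (if v y = w then (1 : ℝ) else 0) ≤ 1 / 4 := by
    rw [← Finset.expect_sum_comm]
    refine (Finset.expect_le_expect fun y _ => ?_).trans hbE'
    rw [Finset.sum_ite_eq]
    split_ifs with hy
    · obtain ⟨x, hx, hxy⟩ := Finset.mem_image.1 hy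
      by_contra! hby
      exact hcon x y (by simpa using hx) hby hxy
    · exact hb' y
  have h4 := Finset.sum_le_sum fun w (_ : w ∈ W) => h1 w
  rw [Finset.sum_sub_distrib, Finset.sum_const, nsmul_eq_mul] at h4
  have h5 : (W.card : ℝ) * η ≤ Fintype.card (I → ZMod p) * η :=
    mul_le_mul_of_nonneg_right (by exact_mod_cast Finset.card_le_univ W) hη0
  linarith

end Distribution

section Approximation

/-- Greedy sampling: some `k`-term sum of mean zero bounded functions has square mean `O(k)`. -/
lemma exists_list_expect_sq_le {V X : Type*} [Fintype V] [Nonempty V] [Fintype X] [Nonempty X]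
    {g : V → X → ℂ} (hg : ∀ v x, ‖g v x‖ ≤ 2) (hg0 : ∀ x, 𝔼 v, g v x = 0) (k : ℕ) :
    ∃ l : List V, l.length = k ∧ 𝔼 x, ‖(l.map fun v => g v x).sum‖ ^ 2 ≤ 4 * (k : ℝ) := by
  induction k with
  | zero => exact ⟨[], rfl, by simp⟩
  | succ k ih =>
    obtain ⟨l, hl, hlE⟩ := ih
    set S : X → ℂ := fun x => (l.map fun v => g v x).sum with hS
    have h1 : ∀ x, 𝔼 v, ‖g v x + S x‖ ^ 2 ≤ 4 + ‖S x‖ ^ 2 := by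
      intro x
      have h2 : 𝔼 v, (g v x * (starRingEnd ℂ) (S x)).re = 0 := by
        have : (𝔼 v, g v x * (starRingEnd ℂ) (S x)).re = 𝔼 v, (g v x * (starRingEnd ℂ) (S x)).re := by
          rw [Fintype.expect_eq_sum_div_card, Fintype.expect_eq_sum_div_card,
            Complex.div_natCast_re, Complex.re_sum]
        rw [← this, ← Finset.expect_mul, hg0, zero_mul, Complex.zero_re]
      have h3 : ∀ v, ‖g v x + S x‖ ^ 2
          = ‖g v x‖ ^ 2 + ‖S x‖ ^ 2 + 2 * (g v x * (starRingEnd ℂ) (S x)).re := by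
        intro v
        simp only [← Complex.normSq_eq_norm_sq, Complex.normSq_add]
      simp only [h3]
      rw [Finset.expect_add_distrib, Finset.expect_add_distrib, ← Finset.mul_expect, h2,
        Fintype.expect_const]
      have h4 : 𝔼 v, ‖g v x‖ ^ 2 ≤ 4 := by
        refine Finset.expect_le Finset.univ_nonempty fun v _ => ?_
        nlinarith [hg v x, norm_nonneg (g v x)]
      linarith
    have h5 : 𝔼 v, 𝔼 x, ‖g v x + S x‖ ^ 2 ≤ 4 * ((k + 1 : ℕ) : ℝ) := by
      rw [Finset.expect_comm]
      refine (Finset.expect_le_expect fun x _ => h1 x).trans ?_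
      rw [Finset.expect_add_distrib, Fintype.expect_const]
      push_cast
      linarith
    obtain ⟨v, -, hv⟩ := Finset.exists_le_of_expect_le Finset.univ_nonempty h5
    exact ⟨v :: l, by simp [hl], by simpa using hv⟩

lemma sum_map_sub_const {V : Type*} (l : List V) (f : V → ℂ) (a : ℂ) :
    (l.map fun v => f v - a).sum = (l.map f).sum - l.length * a := by
  induction l with
  | nil => simp
  | cons v l ih =>
    simp only [List.map_cons, List.sum_cons, ih, List.length_cons, Nat.cast_add, Nat.cast_one]
    ring

lemma exists_stdAddChar_gap (p : ℕ) [Fact p.Prime] : ∃ c : ℝ, 0 < c ∧ ∀ a b : ZMod p, a ≠ b →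
    c ≤ ‖(ZMod.stdAddChar a : ℂ) - ZMod.stdAddChar b‖ := by
  obtain ⟨⟨a, ha⟩, -, hmin⟩ := Finset.exists_min_image
    (Finset.univ : Finset {a : ZMod p × ZMod p // a.1 ≠ a.2})
    (fun a => ‖(ZMod.stdAddChar a.1.1 : ℂ) - ZMod.stdAddChar a.1.2‖)
    ⟨⟨(0, 1), zero_ne_one⟩, Finset.mem_univ _⟩
  refine ⟨_, norm_pos_iff.2 (sub_ne_zero.2 fun h => ha (ZMod.injective_stdAddChar h)),
    fun x y hxy => hmin ⟨(x, y), hxy⟩ (Finset.mem_univ _)⟩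

/-- A biased function is determined, up to a small error, by boundedly many of its derivatives.
The error is measured by the function `b`, which is at least `1` at every exceptional point. -/
lemma exists_derivatives_determine (p : ℕ) [Fact p.Prime] {δ σ : ℝ} (hδ : 0 < δ) (hσ : 0 < σ) :
    ∃ k, ∀ (V : Type) [AddCommGroup V] [Fintype V] (P : V → ZMod p), δ ≤ ‖expSum P‖ →
      ∃ (l : List V) (b : V → ℝ), l.length = k ∧ (∀ x, 0 ≤ b x) ∧ 𝔼 x, b x ≤ σ ∧
        ∀ x y, b x < 1 → b y < 1 → (∀ h ∈ l, fwdDiff h P x = fwdDiff h P y) → P x = P y := by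
  obtain ⟨c, hc, hgap⟩ := exists_stdAddChar_gap p
  set τ : ℝ := δ * c / 2 with hτ
  have hτ0 : 0 < τ := by positivity
  obtain ⟨k, hk⟩ := exists_nat_gt (4 / (τ ^ 2 * σ))
  have hk0 : (0 : ℝ) < k := (by positivity : (0 : ℝ) ≤ 4 / (τ ^ 2 * σ)).trans_lt hk
  refine ⟨k, fun V _ _ P hP => ?_⟩
  set g : V → V → ℂ := fun h x =>
    ZMod.stdAddChar (fwdDiff h P x) - expSum P * ZMod.stdAddChar (-P x) with hg
  have hP1 : ‖expSum P‖ ≤ 1 := (RCLike.norm_expect_le (K := ℂ)).trans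
    (Finset.expect_le Finset.univ_nonempty fun x _ => (norm_stdAddChar _).le)
  have hg2 : ∀ v x, ‖g v x‖ ≤ 2 := by
    intro v x
    refine (norm_sub_le _ _).trans ?_
    rw [norm_mul, norm_stdAddChar, norm_stdAddChar]
    linarith
  have hg0 : ∀ x, 𝔼 v, g v x = 0 := by
    intro x
    simp only [hg, fwdDiff, sub_eq_add_neg, AddChar.map_add_eq_mul]
    rw [Finset.expect_add_distrib, Fintype.expect_const, ← Finset.expect_mul]
    have := expSum_translate P x
    rw [expSum] at this
    rw [this, add_neg_cancel]
  obtain ⟨l, hl, hlE⟩ := exists_list_expect_sq_le hg2 hg0 k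
  refine ⟨l, fun x => ‖(l.map fun v => g v x).sum‖ ^ 2 / (k * τ) ^ 2, hl,
    fun x => by positivity, ?_, fun x y hx hy hxy => ?_⟩
  · rw [← Finset.expect_div, div_le_iff₀ (by positivity)]
    refine hlE.trans ?_
    rw [div_lt_iff₀ (by positivity)] at hk
    nlinarith
  · by_contra hne
    have hsum : ∀ z, (l.map fun v => g v z).sum = (l.map fun v =>
        (ZMod.stdAddChar (fwdDiff v P z) : ℂ)).sum - k * (expSum P * ZMod.stdAddChar (-P z)) := by
      intro z
      rw [← hl]
      exact sum_map_sub_const l _ _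
    have heq : (l.map fun v => (ZMod.stdAddChar (fwdDiff v P x) : ℂ))
        = l.map fun v => (ZMod.stdAddChar (fwdDiff v P y) : ℂ) :=
      List.map_congr_left fun v hv => by rw [hxy v hv]
    have hlt : ∀ z, ‖(l.map fun v => g v z).sum‖ ^ 2 / (k * τ) ^ 2 < 1 →
        ‖(l.map fun v => g v z).sum‖ < k * τ := by
      intro z hz
      rw [div_lt_one (by positivity)] at hz
      exact lt_of_pow_lt_pow_left₀ 2 (by positivity) hz
    have h1 := norm_sub_le (l.map fun v => g v y).sum (l.map fun v => g v x).sum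
    have h2 : (l.map fun v => g v y).sum - (l.map fun v => g v x).sum
        = k * (expSum P * (ZMod.stdAddChar (-P x) - ZMod.stdAddChar (-P y))) := by
      rw [hsum, hsum, heq]
      ring
    rw [h2, norm_mul, norm_mul, Complex.norm_natCast] at h1
    have h3 := hgap (-P x) (-P y) fun h => hne (neg_injective h)
    have h4 : δ * c ≤ ‖expSum P‖
        * ‖(ZMod.stdAddChar (-P x) : ℂ) - ZMod.stdAddChar (-P y)‖ :=
      mul_le_mul hP h3 hc.le (norm_nonneg _)
    have h5 := mul_le_mul_of_nonneg_left h4 hk0.le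
    have h6 := hlt x hx
    have h7 := hlt y hy
    have h8 : (k : ℝ) * (δ * c) = 2 * (k * τ) := by rw [hτ]; ring
    linarith

end Approximation

section Main

variable {p : ℕ} [Fact p.Prime]

lemma expect_cube_vertex {V : Type} [AddCommGroup V] [Fintype V] {K : Type} [Fintype K]
    [DecidableEq K] {T : Finset K} (hT : T ≠ ∅) (b : V → ℝ) (x : V) :
    𝔼 h : K → V, b (x + ∑ i ∈ T, h i) = 𝔼 v, b v := by
  obtain ⟨i, hi⟩ := Finset.nonempty_iff_ne_empty.2 hT
  rw [expect_update i, ← Fintype.expect_const (ι := K → V) (𝔼 v, b v)]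
  refine Finset.expect_congr rfl fun h _ => ?_
  refine Fintype.expect_equiv (Equiv.addLeft (x + ∑ j ∈ T.erase i, h j)) _ _ fun v => ?_
  rw [← Finset.add_sum_erase T _ hi, Function.update_self, Finset.sum_congr rfl fun j hj =>
    Function.update_of_ne (Finset.ne_of_mem_erase hj) v h, Equiv.coe_addLeft]
  rw [add_comm v, ← add_assoc]

theorem biasImpliesRank (d : ℕ) (hd : d < p) : BiasImpliesRank p d := by
  classical
  induction d using Nat.strong_induction_on with
  | _ d ih =>
  intro δ hδ
  set K := Fin (d + 1)
  obtain ⟨k, hk⟩ := exists_derivatives_determine p hδ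
    (σ := 1 / (4 * Fintype.card (Finset K))) (by positivity)
  have hε : ∀ m : ℕ, ∃ ε : ℝ, 0 < ε ∧ ε ≤ 1 ∧
      (p : ℝ) ^ (m * Fintype.card (Finset K)) * (2 * ε) < 1 / 2 := by
    intro m
    have hp : (1 : ℝ) ≤ (p : ℝ) ^ (m * Fintype.card (Finset K)) :=
      one_le_pow₀ (by exact_mod_cast (Fact.out : p.Prime).one_lt.le)
    refine ⟨1 / (8 * (p : ℝ) ^ (m * Fintype.card (Finset K))), by positivity, ?_, ?_⟩
    · rw [div_le_one (by positivity)]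
      linarith
    · field_simp
      norm_num
  choose ε hε0 hε1 hεp using hε
  choose R hR using fun m => exists_cube_close hd.le (fun j hj => ih j hj (hj.trans hd))
    (hε0 m) (hε1 m)
  obtain ⟨M, hM⟩ := exists_regular_refinement (p := p) d
    (R := fun m => (Finset.range (m + 1)).sup R)
    (fun a b hab => Finset.sup_mono (Finset.range_mono (Nat.add_le_add_right hab 1))) k
  refine ⟨M, fun V _ _ P hP hbias => ?_⟩
  obtain ⟨l, b, hl, hb0, hbE, hdet⟩ := hk V P hbias
  obtain ⟨s, hs, hsM, hreg, hsl⟩ := hM V (l.toFinset.image fun h => (d, fwdDiff h P))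
    (fun q hq => by
      obtain ⟨h, _, rfl⟩ := Finset.mem_image.1 hq
      exact ⟨le_rfl, hP h⟩)
    (Finset.card_image_le.trans (l.toFinset_card_le.trans hl.le))
  have hreg' : RegularFactor (R s.card) s :=
    hreg.anti (Finset.le_sup (f := R) (Finset.self_mem_range_succ _))
  refine ⟨s.image Prod.snd, Finset.card_image_le.trans hsM, fun Q hQ => ?_, fun x y hxy => ?_⟩
  · obtain ⟨q, hq, rfl⟩ := Finset.mem_image.1 hQ
    exact (hs q hq).2.mono (hs q hq).1
  have hatom : SameAtom s x y := fun q hq => hxy _ (Finset.mem_image_of_mem _ hq)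
  have hcube : ∀ z : V, 𝔼 h : K → V, ∑ T ∈ Finset.univ.erase ∅, b (z + ∑ i ∈ T, h i)
      ≤ 1 / 4 := by
    intro z
    rw [Finset.expect_sum_comm, Finset.sum_congr rfl fun T hT =>
      expect_cube_vertex (Finset.ne_of_mem_erase hT) b z, Finset.sum_const, nsmul_eq_mul]
    refine (mul_le_mul (Nat.cast_le.2 (Finset.card_le_univ _)) hbE
      (Finset.expect_nonneg fun v _ => hb0 v) (Nat.cast_nonneg _)).trans (le_of_eq ?_)
    field_simp
  obtain ⟨h, h', hgood, hgood', heq⟩ := exists_eq_of_expSum_close (I := s × Finset K)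
    (u := fun (h : K → V) i => i.1.1.2 (x + ∑ j ∈ i.2, h j))
    (v := fun (h : K → V) i => i.1.1.2 (y + ∑ j ∈ i.2, h j)) (η := 2 * ε s.card)
    (by simpa [Fintype.card_finset] using hεp s.card)
    (fun c => by
      have h1 := hR s.card V s hs hreg' K
        (fun q T => if hq : q ∈ s then c (⟨q, hq⟩, T) else 0) x y hatom
      convert h1 using 5 with h h
      all_goals
        rw [Fintype.sum_prod_type, ← Finset.sum_coe_sort s]
        simp)
    (fun h => Finset.sum_nonneg fun T _ => hb0 _) (fun h => Finset.sum_nonneg fun T _ => hb0 _)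
    (hcube x) (hcube y)
  have hvertex : ∀ T : Finset K, T ≠ ∅ → P (x + ∑ i ∈ T, h i) = P (y + ∑ i ∈ T, h' i) := by
    intro T hT
    have hmem : T ∈ Finset.univ.erase (∅ : Finset K) :=
      Finset.mem_erase.2 ⟨hT, Finset.mem_univ T⟩
    refine hdet _ _
      ((Finset.single_le_sum (f := fun T => b (x + ∑ i ∈ T, h i)) (fun T _ => hb0 _) hmem).trans_lt
        hgood)
      ((Finset.single_le_sum (f := fun T => b (y + ∑ i ∈ T, h' i)) (fun T _ => hb0 _)
        hmem).trans_lt hgood') fun v hv => ?_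
    exact hsl _ _ (fun q hq => congrFun heq (⟨q, hq⟩, T)) (d, fwdDiff v P)
      (Finset.mem_image_of_mem _ (List.mem_toFinset.2 hv))
  have hexpand : ∀ (z : V) (w : K → V), P z = -∑ T ∈ Finset.univ.erase (∅ : Finset K),
      (-1) ^ T.card * P (z + ∑ i ∈ T, w i) := by
    intro z w
    have h1 := hP.sum_cube_eq_zero (Finset.univ : Finset K) (by simp [K]) z w
    rw [Finset.powerset_univ, ← Finset.add_sum_erase _ _ (Finset.mem_univ ∅)] at h1
    rw [eq_neg_iff_add_eq_zero, ← h1]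
    simp
  rw [hexpand x h, hexpand y h']
  congr 1
  exact Finset.sum_congr rfl fun T hT => by rw [hvertex T (Finset.ne_of_mem_erase hT)]

end Main

theorem mainTheorem1 (p : ℕ) [Fact p.Prime] (d : ℕ) (hd : d < p) (δ : ℝ) (hδ : 0 < δ)
    (hδ1 : δ ≤ 1) :
    ∃ C : ℕ, ∀ (n : ℕ) (P : (Fin n → ZMod p) → ZMod p),
      IsPolyDegreeLE (d : ℤ) P →
      δ ≤ ‖𝔼 x : Fin n → ZMod p, (ZMod.stdAddChar (P x) : ℂ)‖ →
      degreeRank ((d : ℤ) - 1) P ≤ (C : ℕ∞) := by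
  obtain ⟨C, hC⟩ := biasImpliesRank d hd δ hδ
  exact ⟨C, fun n P hP hbias =>
    (hC _ P ((isPolyDegreeLE_iff (by omega)).1 hP) hbias).degreeRank_le⟩
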